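/- Let $\mathcal V$ be a finite vertex set and let $w(i,j)=w(j,i)\ge 0$ be the edge weights of an undirected weighted graph on $\mathcal V$ (weight $0$ means no edge), with Laplacian $\mathsf L=\mathsf D-\mathsf W$, where $\mathsf W=[w(i,j)]$ and $\mathsf D_{ii}=\sum_j w(i,j)$. Let $q_i\ge 0$ for $i\in\mathcal V$ be such that the graph extended by a node $\Gamma$, joined to each $i$ by an edge of weight $q_i$, is connected. Put $\mathsf Q=\mathrm{diag}(q_i)$. A rooted spanning forest $\phi$ is an acyclic subgraph containing all vertices, with one root chosen in each of its trees; $\rho(\phi)$ is its set of roots, $r_\phi(i)$ the root of the tree containing $i$, and $\pi(\phi)$ the partition of $\mathcal V$ into the vertex sets of the trees. Let $\Phi$ be a random rooted spanning forest with $\mathbb P(\Phi=\phi)\propto\prod_{i\in\rho(\phi)}q_i\prod_{(i,j)\in\phi}w(i,j)$. Let $y\in\mathbb R^{\mathcal V}$ be fixed. Write $\mathcal V_{t(i)}$ for the vertex set of the tree of $\Phi$ containing $i$, and define $$\tilde x(i)=y(r_\Phi(i)),\qquad \bar x(i)=\frac{\sum_{j\in\mathcal V_{t(i)}}q_j\,y(j)}{\sum_{j\in\mathcal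 V_{t(i)}}q_j},\qquad \mathsf S_{ij}=\frac{q_j\,\mathbb I(j\in\mathcal V_{t(i)})}{\sum_{k\in\mathcal V_{t(i)}}q_k}.$$ (The denominators are almost surely positive; a quotient by $0$ is read as $0$.) Then $\mathsf L+\mathsf Q$ is invertible and, with $\mathsf K=(\mathsf L+\mathsf Q)^{-1}\mathsf Q$ and $\hat x=\mathsf Ky$, the following hold. 1. $\bar x$ is the Rao–Blackwellization of $\tilde x$: $\mathbb E[\tilde x(i)\mid\pi(\Phi)=\mathcal P]$ equals the value of $\bar x(i)$ on $\{\pi(\Phi)=\mathcal P\}$, for every $i$ and every partition $\mathcal P$ with $\mathbb P(\pi(\Phi)=\mathcal P)>0$. 2. $\bar x=\mathsf Sy$, $\mathbb E[\mathsf S]=\mathsf K$, and $\mathsf S^\top\mathsf Q\mathsf S=\mathsf Q\mathsf S$. 3. $\bar x$ has finite second moments and is unbiased: $\mathbb E[\bar x]=\hat x$. 4. With $\|v\|_{\mathsf Q}^2=v^\top\mathsf Qv$, $$\mathbb E\left(\|\hat x-\bar x\|^2_{\mathsf Q}\right)=\sum_{i\in\mathcal V}q_i\,\mathrm{Var}(\bar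 x(i))=y^\top(\mathsf Q\mathsf K-\mathsf K^\top\mathsf Q\mathsf K)y.$$ -/

import Mathlib

open MeasureTheory ProbabilityTheory
open scoped Matrix

noncomputable section

/-- An undirected weighted graph on the vertex set `V`: `w i j` is the positive weight of the edge
between `i` and `j`, and `0` when there is no such edge. -/
structure WeightedGraph (V : Type*) where
  w : V → V → ℝ
  nonneg : ∀ i j, 0 ≤ w i j
  symm : ∀ i j, w i j = w j i

namespace WeightedGraph

variable {V : Type*}

/-- The simple graph whose edges are the pairs of distinct vertices joined by an edge. -/
def toSimpleGraph (G : WeightedGraph V) : SimpleGraph V where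
  Adj i j := i ≠ j ∧ 0 < G.w i j
  symm := ⟨fun i j h => ⟨h.1.symm, G.symm i j ▸ h.2⟩⟩
  loopless := ⟨fun _ h => h.1 rfl⟩

/-- The extended graph: a node `Γ` (here `none`) is added, and joined to every vertex `i` by an
edge of weight `q i` (no edge when `q i = 0`). -/
def extend (G : WeightedGraph V) (q : V → ℝ) (hq : ∀ i, 0 ≤ q i) : WeightedGraph (Option V) where
  w
    | some i, some j => G.w i j
    | some i, none => q i
    | none, some j => q j
    | none, none => 0
  nonneg
    | some i, some j => G.nonneg i j
    | some i, none => hq i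
    | none, some j => hq j
    | none, none => le_rfl
  symm
    | some i, some j => G.symm i j
    | some _, none => rfl
    | none, some _ => rfl
    | none, none => rfl

/-- The weight of an unordered pair of vertices. -/
def edgeWeight (G : WeightedGraph V) : Sym2 V → ℝ :=
  Sym2.lift ⟨G.w, G.symm⟩

/-- The graph Laplacian `L = D - W`. -/
def laplacian [Fintype V] [DecidableEq V] (G : WeightedGraph V) : Matrix V V ℝ :=
  Matrix.diagonal (fun i => ∑ j, G.w i j) - Matrix.of G.w

/-- The matrix `K = (L + Q)⁻¹ Q` with `Q = diag q`. -/
def kernel [Fintype V] [DecidableEq V] (G : WeightedGraph V) (q : V → ℝ) : Matrix V V ℝ :=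
  (G.laplacian + Matrix.diagonal q)⁻¹ * Matrix.diagonal q

end WeightedGraph

/-- A rooted spanning forest of `G`: an acyclic subgraph on all the vertices, together with a set
of roots that contains exactly one vertex of each of its trees (connected components). Orienting
every edge towards the root of its tree is then determined. -/
@[ext]
structure RootedSpanningForest {V : Type*} (G : WeightedGraph V) where
  graph : SimpleGraph V
  le : graph ≤ G.toSimpleGraph
  acyclic : graph.IsAcyclic
  roots : Finset V
  existsUnique_root : ∀ i, ∃! r, r ∈ roots ∧ graph.Reachable i r

namespace RootedSpanningForest

variable {V : Type*} {G : WeightedGraph V}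

/-- Rooted spanning forests form a discrete measurable space. -/
instance : MeasurableSpace (RootedSpanningForest G) := ⊤

/-- The root `r_φ(i)` of the tree of `φ` that contains `i`. -/
def root (φ : RootedSpanningForest G) (i : V) : V :=
  (φ.existsUnique_root i).choose

/-- The partition `π(φ)` of the vertices into the trees of `φ`, as an equivalence relation. -/
def partition (φ : RootedSpanningForest G) : Setoid V :=
  φ.graph.reachableSetoid

variable [Fintype V]

open Classical in
/-- The set of vertices of the tree of `φ` that contains `i`. -/
def tree (φ : RootedSpanningForest G) (i : V) : Finset V :=
  Finset.univ.filter (fun j => φ.partition i j)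

open Classical in
/-- The unnormalized probability `∏_{i ∈ ρ(φ)} q_i ∏_{(i,j) ∈ φ} w(i,j)` of the forest `φ`. -/
def weight (q : V → ℝ) (φ : RootedSpanningForest G) : ℝ :=
  (∏ i ∈ φ.roots, q i) * ∏ e ∈ φ.graph.edgeFinset, G.edgeWeight e

/-- The estimator `x̃`, which propagates the measurement of each root to its tree. -/
def xtilde (y : V → ℝ) (φ : RootedSpanningForest G) (i : V) : ℝ :=
  y (φ.root i)

/-- The estimator `x̄`, which takes in each tree the average of `y` with weights `q`. -/
def xbar (q y : V → ℝ) (φ : RootedSpanningForest G) (i : V) : ℝ :=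
  (∑ j ∈ φ.tree i, y j * q j) / ∑ j ∈ φ.tree i, q j

open Classical in
/-- The partition-averaging matrix `S`. -/
def S (q : V → ℝ) (φ : RootedSpanningForest G) : Matrix V V ℝ :=
  Matrix.of fun i j => q j * (if j ∈ φ.tree i then 1 else 0) / ∑ k ∈ φ.tree i, q k

end RootedSpanningForest

/-- `Φ` is a random spanning forest with parameters `q`: a random variable with values in the
rooted spanning forests of `G`, whose law is proportional to the forest weight. -/
structure IsRandomSpanningForest {V : Type*} [Fintype V] {G : WeightedGraph V} (q : V → ℝ)
    {Ω : Type*} [MeasurableSpace Ω] (μ : Measure Ω) (Φ : Ω → RootedSpanningForest G) : Prop where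
  measurable : Measurable Φ
  law : ∃ c : ℝ, ∀ φ, μ.real {ω | Φ ω = φ} = c * φ.weight q

/-- The squared weighted norm `‖v‖²_Q = vᵀ Q v` with `Q = diag q`. -/
def weightedSqNorm {V : Type*} [Fintype V] [DecidableEq V] (q v : V → ℝ) : ℝ :=
  v ⬝ᵥ (Matrix.diagonal q *ᵥ v)

end

/-! Orient every edge of a rooted forest towards its root. The forest becomes a parent map `f : V →
Option V` without cycles, and its weight the product over `i` of the extended weight from `i` to `f
i`, where `none` stands for `Γ`.

Unbiasedness comes from a harmonic equation: `i ↦ ∑ φ, weight φ * y (root φ i)` solves `(L + Q) h =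
Z q y`, with `Z` the total weight. It is proved by a sign-reversing involution on pairs (parent map,
candidate edge out of `i`), which swaps the candidate with the current edge
(`sum_parentMaps_laplace`). As `L + Q` is invertible, by its Dirichlet form and connectedness,
`E[x̃] = K y`.

Given the partition, moving the root of one tree only exchanges one factor `q`, so that root has law
proportional to `q` on its tree (`sum_weight_mul_xtilde`). Hence `x̄` is the conditional mean of
`x̃` and inherits its expectation.

For the error, `Sᵀ Q S = Q S` turns the quadratic quantity `∑ q x̄²` into `∑ q y x̄`, linear in
`x̄`, whose expectation is known. -/

noncomputable section

/-! ### Parent maps and the roots they lead to -/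

/-- Following the parent map `f` from `i` one arrives at `r`, which has no parent. -/
inductive RootedAt {V : Type*} (f : V → Option V) : V → V → Prop
  | base {i : V} : f i = none → RootedAt f i i
  | step {i j r : V} : f i = some j → RootedAt f j r → RootedAt f i r

namespace RootedAt

variable {V : Type*} {f : V → Option V} {i j k r s : V}

theorem unique (h : RootedAt f i r) (h' : RootedAt f i s) : r = s := by
  induction h with
  | base h =>
    cases h' with
    | base _ => rfl
    | step h1 _ => simp [h] at h1
  | step h _ ih =>
    cases h' with
    | base h1 => simp [h] at h1
    | step h1 h2 =>
      rw [h, Option.some_inj] at h1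
      exact ih (h1 ▸ h2)

theorem eq_none (h : RootedAt f i r) : f r = none := by
  induction h with
  | base h => exact h
  | step _ _ ih => exact ih

/-- As `f` is single-valued, a cycle through `i` also passes through its parent, hence is carried
along to the root, which has no outgoing step. -/
theorem not_transGen (h : RootedAt f i r) :
    ¬ Relation.TransGen (fun a b => f a = some b) i i := by
  induction h with
  | base h =>
    intro ht
    obtain ⟨b, hb, -⟩ := Relation.TransGen.head'_iff.1 ht
    simp [h] at hb
  | step h _ ih =>
    intro ht
    obtain ⟨b, hb, hbi⟩ := Relation.TransGen.head'_iff.1 ht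
    rw [h, Option.some_inj] at hb
    subst hb
    exact ih (Relation.TransGen.tail' hbi h)

theorem of_reflTransGen (h : RootedAt f i r)
    (hij : Relation.ReflTransGen (fun a b => f a = some b) i j) : RootedAt f j r := by
  induction hij with
  | refl => exact h
  | tail _ hbc ih =>
    cases ih with
    | base h => simp [h] at hbc
    | step h h' =>
      rw [h, Option.some_inj] at hbc
      exact hbc ▸ h'

variable [DecidableEq V]

theorem update (h : RootedAt f k r)
    (hk : ¬ Relation.ReflTransGen (fun a b => f a = some b) k i) (c : Option V) :
    RootedAt (Function.update f i c) k r := by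
  induction h with
  | @base a h =>
    have : a ≠ i := by rintro rfl; exact hk .refl
    exact .base (by simpa [Function.update_of_ne this] using h)
  | @step a b r h _ ih =>
    have : a ≠ i := by rintro rfl; exact hk .refl
    exact .step (by simpa [Function.update_of_ne this] using h)
      (ih fun hb => hk (.head h hb))

end RootedAt

/-- Every vertex is led to a root by the parent map `f`. -/
def IsRooted {V : Type*} (f : V → Option V) : Prop := ∀ i, ∃ r, RootedAt f i r

theorem not_reflTransGen_update {V : Type*} [DecidableEq V] {f : V → Option V} {i k : V}
    (hk : ¬ Relation.ReflTransGen (fun a b => f a = some b) k i) (c : Option V) :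
    ¬ Relation.ReflTransGen (fun a b => Function.update f i c a = some b) k i := by
  intro h
  induction h using Relation.ReflTransGen.head_induction_on with
  | refl => exact hk .refl
  | @head a b hab _ ih =>
    have : a ≠ i := by rintro rfl; exact hk .refl
    rw [Function.update_of_ne this] at hab
    exact ih fun hb => hk (.head hab hb)

namespace IsRooted

variable {V : Type*} {f : V → Option V}

/-- The hypothesis says that the new edge out of `i` closes no cycle. Any other vertex follows its
old path to its root, or until it meets `i`. -/
theorem update [DecidableEq V] (h : IsRooted f) {i : V} {c : Option V}
    (hc : ∀ k, c = some k → ¬ Relation.ReflTransGen (fun a b => f a = some b) k i) :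
    IsRooted (Function.update f i c) := by
  have hi : ∃ s, RootedAt (Function.update f i c) i s := by
    cases c with
    | none => exact ⟨i, .base (by simp)⟩
    | some k =>
      obtain ⟨r, hr⟩ := h k
      exact ⟨r, .step (by simp) (hr.update (hc k rfl) _)⟩
  intro a
  obtain ⟨r, hr⟩ := h a
  induction hr with
  | @base a ha =>
    by_cases hai : a = i
    · exact hai ▸ hi
    · exact ⟨a, .base (by rwa [Function.update_of_ne hai])⟩
  | @step a b r ha _ ih =>
    by_cases hai : a = i
    · exact hai ▸ hi
    · obtain ⟨s, hs⟩ := ih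
      exact ⟨s, .step (by rwa [Function.update_of_ne hai]) hs⟩

theorem not_reflTransGen (h : IsRooted f) {i k : V} (hi : f i = some k) :
    ¬ Relation.ReflTransGen (fun a b => f a = some b) k i := by
  obtain ⟨r, hr⟩ := h i
  exact fun hk => hr.not_transGen (.head' hi hk)

end IsRooted

open Classical in
/-- The root to which the parent map `f` leads from `i`. -/
def rootOf {V : Type*} (f : V → Option V) (i : V) : V :=
  if h : ∃ r, RootedAt f i r then h.choose else i

theorem RootedAt.rootOf_eq {V : Type*} {f : V → Option V} {i r : V} (h : RootedAt f i r) :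
    rootOf f i = r := by
  have h' : ∃ r, RootedAt f i r := ⟨r, h⟩
  rw [rootOf, dif_pos h']
  exact h'.choose_spec.unique h

theorem IsRooted.rootedAt {V : Type*} {f : V → Option V} (h : IsRooted f) (i : V) :
    RootedAt f i (rootOf f i) := by
  obtain ⟨r, hr⟩ := h i
  rwa [hr.rootOf_eq]

theorem IsRooted.rootOf_eq_elim {V : Type*} {f : V → Option V} (h : IsRooted f) (i : V) :
    rootOf f i = (f i).elim i (rootOf f) := by
  cases hi : f i with
  | none => exact (RootedAt.base hi).rootOf_eq
  | some j => exact (RootedAt.step hi (h.rootedAt j)).rootOf_eq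

/-! ### The edge-swapping involution -/

open Classical in
/-- The function `i ↦ ∑_f W(f) y(r_f(i))`, over the parent maps of rooted forests, satisfies the
Laplace equation with source. -/
theorem sum_parentMaps_laplace {V : Type*} [Fintype V] (c : V → Option V → ℝ) (y : V → ℝ)
    (i : V) :
    ∑ p ∈ ({f | IsRooted f} : Finset (V → Option V)) ×ˢ (Finset.univ : Finset (Option V)),
      (∏ a, c a (p.1 a)) * c i p.2 * (y (rootOf p.1 i) - p.2.elim (y i) fun k => y (rootOf p.1 k))
      = 0 := by
  set T : (V → Option V) × Option V → ℝ := fun p =>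
    (∏ a, c a (p.1 a)) * c i p.2 * (y (rootOf p.1 i) - p.2.elim (y i) fun k => y (rootOf p.1 k))
    with hT
  -- The degenerate pairs, where the candidate edge out of `i` would close a cycle. They are the
  -- pairs on which no swap is possible.
  set D : (V → Option V) × Option V → Prop := fun p =>
    ∃ k, p.2 = some k ∧ Relation.ReflTransGen (fun a b => p.1 a = some b) k i with hD
  set g : (V → Option V) × Option V → (V → Option V) × Option V := fun p =>
    if D p then p else (Function.update p.1 i p.2, p.1 i) with hg
  have hDg : ∀ p, IsRooted p.1 → ¬ D p → ¬ D (g p) := by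
    rintro ⟨f, k⟩ hf hp ⟨k', hk', h⟩
    simp only [hg, if_neg hp] at hk' h
    exact not_reflTransGen_update (hf.not_reflTransGen hk') _ h
  have hroot : ∀ p, IsRooted p.1 → IsRooted (g p).1 := by
    rintro ⟨f, k⟩ hf
    by_cases hp : D (f, k)
    · simpa only [hg, if_pos hp] using hf
    · simp only [hg, if_neg hp]
      exact hf.update fun a ha hai => hp ⟨a, ha, hai⟩
  have hgg : ∀ p, IsRooted p.1 → g (g p) = p := by
    intro p hf
    by_cases hp : D p
    · simp only [hg, if_pos hp]
    · have h1 := hDg p hf hp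
      rw [hg] at h1 ⊢
      simp only [if_neg hp] at h1 ⊢
      simp only [if_neg h1]
      ext <;> simp
  have hTg : ∀ p, IsRooted p.1 → T (g p) = - T p := by
    rintro ⟨f, k⟩ hf
    by_cases hp : D (f, k)
    · simp only [hg, if_pos hp]
      -- At a fixed point the term must vanish: `i` lies on the path from `a`, so both have the same
      -- root.
      obtain ⟨a, ha, hai⟩ := hp
      obtain rfl : k = some a := ha
      have := ((hf.rootedAt a).of_reflTransGen hai).rootOf_eq
      simp [hT, this]
    · have hf' := hroot _ hf
      replace hf : IsRooted f := hf
      simp only [hg, if_neg hp] at hf' ⊢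
      set f' := Function.update f i k with hf'def
      -- The extra factor for the candidate edge makes the weight of the pair symmetric under the
      -- swap.
      have hprod : (∏ a, c a (f' a)) * c i (f i) = (∏ a, c a (f a)) * c i k := by
        rw [← Finset.mul_prod_erase Finset.univ (fun a => c a (f' a)) (Finset.mem_univ i),
          ← Finset.mul_prod_erase Finset.univ (fun a => c a (f a)) (Finset.mem_univ i)]
        have : ∏ a ∈ Finset.univ.erase i, c a (f' a) = ∏ a ∈ Finset.univ.erase i, c a (f a) := by
          refine Finset.prod_congr rfl fun a ha => ?_
          rw [hf'def, Function.update_of_ne (Finset.ne_of_mem_erase ha)]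
        rw [this, hf'def, Function.update_self]
        ring
      have hup : ∀ a, ¬ Relation.ReflTransGen (fun a b => f a = some b) a i →
          rootOf f' a = rootOf f a := fun a ha => ((hf.rootedAt a).update ha k).rootOf_eq
      -- The swap exchanges the two terms of the difference: paths that avoid `i` do not see the
      -- change at `i`.
      have h1 : y (rootOf f' i) = k.elim (y i) fun a => y (rootOf f a) := by
        rw [hf'.rootOf_eq_elim, hf'def, Function.update_self, ← hf'def]
        cases k with
        | none => rfl
        | some a => exact congrArg y (hup a fun h => hp ⟨a, rfl, h⟩)
      have h2 : y (rootOf f i) = (f i).elim (y i) fun a => y (rootOf f' a) := by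
        rw [hf.rootOf_eq_elim]
        cases hi : f i with
        | none => rfl
        | some a => exact congrArg y (hup a (hf.not_reflTransGen hi)).symm
      simp only [hT]
      rw [hprod, h1, ← h2]
      ring
  have hsum : ∑ p ∈ ({f | IsRooted f} : Finset (V → Option V)) ×ˢ
      (Finset.univ : Finset (Option V)), T p = ∑ p ∈ ({f | IsRooted f} : Finset (V → Option V)) ×ˢ
      (Finset.univ : Finset (Option V)), - T p := by
    refine Finset.sum_nbij' g g ?_ ?_ ?_ ?_ ?_
    · intro p hp; simp at hp ⊢; exact hroot p hp
    · intro p hp; simp at hp ⊢; exact hroot p hp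
    · intro p hp; simp at hp; exact hgg p hp
    · intro p hp; simp at hp; exact hgg p hp
    · intro p hp; simp at hp; rw [hTg p hp, neg_neg]
  rw [Finset.sum_neg_distrib] at hsum
  linarith

/-! ### From rooted forests to parent maps -/

namespace RootedSpanningForest

variable {V : Type*} {G : WeightedGraph V} (φ : RootedSpanningForest G)

theorem root_mem (i : V) : φ.root i ∈ φ.roots := (φ.existsUnique_root i).choose_spec.1.1

theorem reachable_root (i : V) : φ.graph.Reachable i (φ.root i) :=
  (φ.existsUnique_root i).choose_spec.1.2

variable {φ}

theorem root_eq {i r : V} (hr : r ∈ φ.roots) (hir : φ.graph.Reachable i r) : φ.root i = r :=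
  ((φ.existsUnique_root i).choose_spec.2 r ⟨hr, hir⟩).symm

theorem root_eq_root {i j : V} (h : φ.graph.Reachable i j) : φ.root i = φ.root j :=
  root_eq (φ.root_mem j) (h.trans (φ.reachable_root j))

theorem mem_roots_iff {i : V} : i ∈ φ.roots ↔ φ.root i = i :=
  ⟨fun h => root_eq h .rfl, fun h => h ▸ φ.root_mem i⟩

variable (φ) in
/-- `j` is the neighbour of `i` on the path from `i` to its root. -/
def IsParent (i j : V) : Prop :=
  φ.graph.Adj i j ∧ φ.graph.dist (φ.root i) i = φ.graph.dist (φ.root i) j + 1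

theorem isParent_or_isParent {i j : V} (h : φ.graph.Adj i j) :
    φ.IsParent i j ∨ φ.IsParent j i := by
  have hr := root_eq_root h.reachable
  rcases φ.acyclic.dist_eq_dist_add_one_of_adj_of_reachable (φ.root i) h
    (φ.reachable_root i).symm with h' | h'
  · exact .inl ⟨h, h'⟩
  · exact .inr ⟨h.symm, hr ▸ h'⟩

/-- Each parent is the second vertex of a geodesic from `i` to the root, and a forest has only one
path between two vertices. -/
theorem IsParent.unique {i j k : V} (hj : φ.IsParent i j) (hk : φ.IsParent i k) : j = k := by
  have key : ∀ {a}, φ.IsParent i a → ∃ p : φ.graph.Walk i (φ.root i), p.IsPath ∧ p.snd = a := by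
    intro a ha
    obtain ⟨p, hp⟩ := (ha.1.symm.reachable.trans (φ.reachable_root i)).exists_walk_length_eq_dist
    refine ⟨.cons ha.1 p, SimpleGraph.Walk.isPath_of_length_eq_dist _ ?_, by simp⟩
    rw [SimpleGraph.Walk.length_cons, hp, SimpleGraph.dist_comm, ← ha.2, SimpleGraph.dist_comm]
  obtain ⟨p, hp, rfl⟩ := key hj
  obtain ⟨p', hp', rfl⟩ := key hk
  have := φ.acyclic.subsingleton_path i (φ.root i) |>.elim ⟨p, hp⟩ ⟨p', hp'⟩
  rw [Subtype.mk.injEq] at this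
  rw [this]

theorem exists_isParent {i : V} (hi : i ∉ φ.roots) : ∃ j, φ.IsParent i j := by
  obtain ⟨p, hp⟩ := (φ.reachable_root i).exists_walk_length_eq_dist
  have hnil : ¬ p.Nil := fun h => hi (mem_roots_iff.2 h.eq.symm)
  refine ⟨p.snd, p.adj_snd hnil, ?_⟩
  have h1 := SimpleGraph.dist_le p.tail
  have h2 := p.length_tail_add_one hnil
  rw [SimpleGraph.dist_comm] at h1 hp
  rcases φ.acyclic.dist_eq_dist_add_one_of_adj_of_reachable (φ.root i) (p.adj_snd hnil)
    (φ.reachable_root i).symm with h' | h'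
  · exact h'
  · omega

theorem IsParent.notMem_roots {i j : V} (h : φ.IsParent i j) : i ∉ φ.roots := by
  intro hi
  have := h.2
  rw [mem_roots_iff.1 hi, SimpleGraph.dist_self] at this
  omega

open Classical in
variable (φ) in
/-- The parent of `i`, which is `none` at the roots. -/
def parent (i : V) : Option V :=
  if h : ∃ j, φ.IsParent i j then some h.choose else none

theorem parent_eq_some {i j : V} : φ.parent i = some j ↔ φ.IsParent i j := by
  unfold parent
  split_ifs with h
  · rw [Option.some_inj]
    exact ⟨fun h' => h' ▸ h.choose_spec, fun h' => h.choose_spec.unique h'⟩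
  · simp only [false_iff]
    exact fun h' => h ⟨j, h'⟩

theorem parent_eq_none {i : V} : φ.parent i = none ↔ i ∈ φ.roots := by
  rw [← not_iff_not, ← ne_eq, Option.ne_none_iff_exists']
  simp only [parent_eq_some]
  exact ⟨fun ⟨j, hj⟩ => hj.notMem_roots, exists_isParent⟩

variable (φ) in
theorem rootedAt_parent (i : V) : RootedAt φ.parent i (φ.root i) := by
  induction h : φ.graph.dist (φ.root i) i generalizing i with
  | zero =>
    have h0 := (φ.reachable_root i).symm.dist_eq_zero_iff.1 h
    rw [h0]
    exact .base (parent_eq_none.2 (mem_roots_iff.2 h0))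
  | succ n ih =>
    have hi : i ∉ φ.roots := by
      intro hi
      rw [mem_roots_iff.1 hi, SimpleGraph.dist_self] at h
      omega
    obtain ⟨j, hj⟩ := exists_isParent hi
    have hr := root_eq_root hj.1.reachable
    have h2 := hj.2
    refine .step (parent_eq_some.2 hj) (hr ▸ ih j ?_)
    rw [← hr]
    omega

variable (φ) in
theorem isRooted_parent : IsRooted φ.parent := fun i => ⟨_, φ.rootedAt_parent i⟩

variable (φ) in
theorem rootOf_parent (i : V) : rootOf φ.parent i = φ.root i := (φ.rootedAt_parent i).rootOf_eq

theorem adj_iff_parent {i j : V} :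
    φ.graph.Adj i j ↔ φ.parent i = some j ∨ φ.parent j = some i := by
  simp only [parent_eq_some]
  exact ⟨isParent_or_isParent, fun h => h.elim (·.1) (·.1.symm)⟩

theorem parent_injective :
    Function.Injective (parent : RootedSpanningForest G → V → Option V) := by
  intro φ ψ h
  ext i j
  · rw [adj_iff_parent, adj_iff_parent, h]
  · rw [← parent_eq_none, ← parent_eq_none, h]

variable [Fintype V]

instance : Finite (RootedSpanningForest G) := Finite.of_injective _ parent_injective

/-- A root pays for its edge to `Γ`, any other vertex for the edge to its parent. Each edge is paid
for once, by its endpoint farther from the root. -/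
theorem weight_eq_prod (q : V → ℝ) (hq : ∀ i, 0 ≤ q i) :
    φ.weight q = ∏ i, (G.extend q hq).w (some i) (φ.parent i) := by
  classical
  rw [weight, ← Finset.prod_mul_prod_compl φ.roots]
  congr 1
  · refine Finset.prod_congr rfl fun i hi => ?_
    rw [parent_eq_none.2 hi]
    rfl
  · symm
    -- The default of `getD` is never taken, since `i` ranges over the non-roots.
    refine Finset.prod_bij (fun i _ => s(i, (φ.parent i).getD i)) ?_ ?_ ?_ ?_
    · intro i hi
      obtain ⟨j, hj⟩ := exists_isParent (Finset.mem_compl.1 hi)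
      simpa [parent_eq_some.2 hj] using hj.1
    · intro i hi i' hi' h
      obtain ⟨j, hj⟩ := exists_isParent (Finset.mem_compl.1 hi)
      obtain ⟨j', hj'⟩ := exists_isParent (Finset.mem_compl.1 hi')
      simp only [parent_eq_some.2 hj, parent_eq_some.2 hj', Option.getD_some, Sym2.eq_iff] at h
      rcases h with h | ⟨rfl, rfl⟩
      · exact h.1
      · have h1 := hj.2
        have h2 := hj'.2
        rw [root_eq_root hj'.1.reachable] at h2
        omega
    · intro e he
      induction e with
      | h i j =>
      rw [SimpleGraph.mem_edgeFinset, SimpleGraph.mem_edgeSet] at he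
      rcases isParent_or_isParent he with h | h
      · exact ⟨i, Finset.mem_compl.2 h.notMem_roots, by simp [parent_eq_some.2 h]⟩
      · exact ⟨j, Finset.mem_compl.2 h.notMem_roots, by simp [parent_eq_some.2 h]⟩
    · intro i hi
      obtain ⟨j, hj⟩ := exists_isParent (Finset.mem_compl.1 hi)
      rw [parent_eq_some.2 hj]
      rfl

end RootedSpanningForest

/-! ### From parent maps back to rooted forests -/

/-- The edges between the vertices and their parents. -/
def parentGraph {V : Type*} (f : V → Option V) : SimpleGraph V :=
  .fromRel fun i j => f i = some j

namespace IsRooted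

variable {V : Type*} {f : V → Option V}

theorem ne (h : IsRooted f) {i j : V} (hij : f i = some j) : i ≠ j := by
  rintro rfl
  exact h.not_reflTransGen hij .refl

theorem parentGraph_adj (h : IsRooted f) {i j : V} :
    (parentGraph f).Adj i j ↔ f i = some j ∨ f j = some i := by
  rw [parentGraph, SimpleGraph.fromRel_adj, and_iff_right_iff_imp]
  exact fun h' => h'.elim h.ne fun h'' => (h.ne h'').symm

theorem rootOf_eq_of_reachable (h : IsRooted f) {i j : V} (hij : (parentGraph f).Reachable i j) :
    rootOf f i = rootOf f j := by
  obtain ⟨p⟩ := hij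
  induction p with
  | nil => rfl
  | cons hadj _ ih =>
    rw [← ih]
    rcases h.parentGraph_adj.1 hadj with h' | h'
    · rw [h.rootOf_eq_elim, h']; rfl
    · rw [h.rootOf_eq_elim (f := f), eq_comm, h.rootOf_eq_elim, h']
      simp [← h.rootOf_eq_elim]

theorem reachable_rootOf (h : IsRooted f) (i : V) :
    (parentGraph f).Reachable i (rootOf f i) := by
  have hi := h.rootedAt i
  revert hi
  generalize rootOf f i = r
  intro hi
  induction hi with
  | base _ => exact .rfl
  | step hij _ ih => exact (h.parentGraph_adj.2 (.inl hij)).reachable.trans ih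

theorem isAcyclic_parentGraph (h : IsRooted f) : (parentGraph f).IsAcyclic := by
  have key : ∀ {i j}, f i = some j → (parentGraph f).IsBridge s(i, j) := by
    intro i j hij
    rw [SimpleGraph.isBridge_iff]
    rintro ⟨p⟩
    -- Once the edge from `i` to its parent `j` is removed, the set of vertices led to `i` is closed
    -- under adjacency. It contains `i` but not `j`, so the edge is a bridge.
    have hinv : ∀ {a b : V}, ((parentGraph f).deleteEdges {s(i, j)}).Walk a b →
        Relation.ReflTransGen (fun a b => f a = some b) a i →
        Relation.ReflTransGen (fun a b => f a = some b) b i := by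
      intro a b p
      induction p with
      | nil => exact id
      | @cons a b c hab _ ih =>
        intro ha
        apply ih
        rw [SimpleGraph.deleteEdges_adj, h.parentGraph_adj, Set.mem_singleton_iff] at hab
        rcases hab.1 with h' | h'
        · rcases Relation.ReflTransGen.cases_head ha with rfl | ⟨b', hb', hbi⟩
          · rw [hij, Option.some_inj] at h'
            exact absurd (by rw [h']) hab.2
          · rw [h', Option.some_inj] at hb'
            exact hb' ▸ hbi
        · exact .head h' ha
    exact h.not_reflTransGen hij (hinv p .refl)
  rw [SimpleGraph.isAcyclic_iff_forall_adj_isBridge]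
  intro i j hij
  rcases h.parentGraph_adj.1 hij with h' | h'
  · exact key h'
  · rw [Sym2.eq_swap]
    exact key h'

theorem exists_parent_eq [Fintype V] {G : WeightedGraph V} (h : IsRooted f)
    (hG : ∀ i j, f i = some j → 0 < G.w i j) :
    ∃ φ : RootedSpanningForest G, φ.parent = f := by
  classical
  let φ : RootedSpanningForest G :=
    { graph := parentGraph f
      le := by
        intro i j hij
        refine ⟨hij.ne, ?_⟩
        rcases h.parentGraph_adj.1 hij with h' | h'
        · exact hG i j h'
        · exact G.symm i j ▸ hG j i h'
      acyclic := h.isAcyclic_parentGraph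
      roots := {i | f i = none}
      existsUnique_root := fun i => by
        refine ⟨rootOf f i, ⟨by simpa using (h.rootedAt i).eq_none, h.reachable_rootOf i⟩, ?_⟩
        rintro r ⟨hr, hir⟩
        rw [h.rootOf_eq_of_reachable hir]
        exact (RootedAt.base (by simpa using hr)).rootOf_eq.symm }
  refine ⟨φ, funext fun i => ?_⟩
  obtain ⟨r, hi⟩ := h i
  induction hi with
  | @base i hi =>
    rw [hi, RootedSpanningForest.parent_eq_none]
    simpa [φ] using hi
  | @step i j r hij _ ih =>
    rw [hij, RootedSpanningForest.parent_eq_some]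
    rcases RootedSpanningForest.isParent_or_isParent (φ := φ)
      (h.parentGraph_adj.2 (.inl hij)) with h' | h'
    · exact h'
    -- The reverse orientation would give `f j = some i`, a 2-cycle with `f i = some j`.
    · rw [← RootedSpanningForest.parent_eq_some, ih] at h'
      exact absurd (.single h') (h.not_reflTransGen hij)

end IsRooted

/-! ### The Laplace equation for sums over forests -/

namespace RootedSpanningForest

variable {V : Type*} [Fintype V] {G : WeightedGraph V}

instance : Fintype (RootedSpanningForest G) := Fintype.ofFinite _

-- A rooted parent map that comes from no forest uses an edge of weight `0`, so it contributes
-- nothing.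
open Classical in
theorem sum_weight_mul_eq_sum_isRooted (q : V → ℝ) (hq : ∀ i, 0 ≤ q i)
    (F : (V → Option V) → ℝ) :
    ∑ φ : RootedSpanningForest G, φ.weight q * F φ.parent =
      ∑ f : V → Option V with IsRooted f, (∏ a, (G.extend q hq).w (some a) (f a)) * F f := by
  refine Finset.sum_of_injOn parent parent_injective.injOn
    (fun φ _ => by simpa using φ.isRooted_parent) ?_ (fun φ _ => by rw [φ.weight_eq_prod q hq])
  intro f hf hf'
  rw [mul_eq_zero_of_left]
  by_contra hne
  replace hne := Finset.prod_ne_zero_iff.1 hne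
  obtain ⟨φ, hφ⟩ := IsRooted.exists_parent_eq (G := G) (by simpa using hf) fun i j hij =>
    (G.nonneg i j).lt_of_ne' (by simpa [hij, WeightedGraph.extend] using hne i (Finset.mem_univ i))
  exact hf' ⟨φ, by simp, hφ⟩

theorem sum_extend_mul_sum_root_sub (q : V → ℝ) (hq : ∀ i, 0 ≤ q i) (y : V → ℝ) (i : V) :
    ∑ k : Option V, (G.extend q hq).w (some i) k *
      ((∑ φ : RootedSpanningForest G, φ.weight q * y (φ.root i)) -
        k.elim (y i * ∑ φ : RootedSpanningForest G, φ.weight q)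
          fun k => ∑ φ : RootedSpanningForest G, φ.weight q * y (φ.root k)) = 0 := by
  classical
  have key := sum_parentMaps_laplace (fun a b => (G.extend q hq).w (some a) b) y i
  rw [Finset.sum_product_right] at key
  rw [← key]
  refine Finset.sum_congr rfl fun k _ => ?_
  simp_rw [mul_assoc]
  have := sum_weight_mul_eq_sum_isRooted (G := G) q hq (fun f => (G.extend q hq).w (some i) k *
        (y (rootOf f i) - k.elim (y i) fun k => y (rootOf f k)))
  simp only [rootOf_parent] at this
  refine Eq.trans ?_ (this.trans ?_)
  · cases k with
    | none =>
      simp only [Option.elim_none, mul_sub, Finset.sum_sub_distrib, Finset.mul_sum]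
      congr 1 <;> exact Finset.sum_congr rfl fun φ _ => by ring
    | some k =>
      simp only [Option.elim_some, mul_sub, Finset.sum_sub_distrib, Finset.mul_sum]
      congr 1 <;> exact Finset.sum_congr rfl fun φ _ => by ring
  · convert rfl

/-- The weighted sums `∑_φ weight(φ) y(r_φ(i))` solve the Laplace equation with source `q y`. -/
theorem laplacian_mulVec_sum_root [DecidableEq V] (q : V → ℝ) (hq : ∀ i, 0 ≤ q i) (y : V → ℝ) :
    (G.laplacian + Matrix.diagonal q) *ᵥ
        (fun i => ∑ φ : RootedSpanningForest G, φ.weight q * y (φ.root i)) =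
      fun i => q i * y i * ∑ φ : RootedSpanningForest G, φ.weight q := by
  funext i
  have key := sum_extend_mul_sum_root_sub (G := G) q hq y i
  set h : V → ℝ := fun i => ∑ φ : RootedSpanningForest G, φ.weight q * y (φ.root i) with hh
  rw [Fintype.sum_option] at key
  simp only [WeightedGraph.extend, Option.elim_none, Option.elim_some, mul_sub,
    Finset.sum_sub_distrib, ← Finset.sum_mul] at key
  rw [Matrix.add_mulVec, Pi.add_apply, WeightedGraph.laplacian, Matrix.sub_mulVec, Pi.sub_apply,
    Matrix.mulVec_diagonal, Matrix.mulVec_diagonal]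
  simp only [Matrix.mulVec, dotProduct, Matrix.of_apply]
  simp only [hh] at key ⊢
  linarith

end RootedSpanningForest

/-! ### Invertibility of `L + Q` -/

namespace WeightedGraph

variable {V : Type*} [Fintype V] [DecidableEq V] (G : WeightedGraph V)

theorem laplacian_mulVec_apply (x : V → ℝ) (i : V) :
    (G.laplacian *ᵥ x) i = ∑ j, G.w i j * (x i - x j) := by
  rw [laplacian, Matrix.sub_mulVec, Pi.sub_apply, Matrix.mulVec_diagonal]
  simp only [Matrix.mulVec, dotProduct, Matrix.of_apply, mul_sub, Finset.sum_sub_distrib,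
    Finset.sum_mul]

theorem two_mul_dotProduct_laplacian_mulVec (x : V → ℝ) :
    2 * (x ⬝ᵥ (G.laplacian *ᵥ x)) = ∑ i, ∑ j, G.w i j * (x i - x j) ^ 2 := by
  have h1 : x ⬝ᵥ (G.laplacian *ᵥ x) = ∑ i, ∑ j, G.w i j * ((x i - x j) * x i) := by
    simp only [dotProduct, laplacian_mulVec_apply, Finset.mul_sum]
    exact Finset.sum_congr rfl fun i _ => Finset.sum_congr rfl fun j _ => by ring
  have h2 : x ⬝ᵥ (G.laplacian *ᵥ x) = ∑ i, ∑ j, G.w i j * ((x j - x i) * x j) := by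
    rw [h1, Finset.sum_comm]
    exact Finset.sum_congr rfl fun i _ => Finset.sum_congr rfl fun j _ => by rw [G.symm]
  rw [two_mul]
  nth_rw 1 [h1]
  rw [h2]
  simp only [← Finset.sum_add_distrib]
  exact Finset.sum_congr rfl fun i _ => Finset.sum_congr rfl fun j _ => by ring

variable {G} in
theorem eq_zero_of_laplacian_add_diagonal_mulVec_eq_zero {q : V → ℝ} (hq : ∀ i, 0 ≤ q i)
    (hconn : (G.extend q hq).toSimpleGraph.Connected) {x : V → ℝ}
    (hx : (G.laplacian + Matrix.diagonal q) *ᵥ x = 0) : x = 0 := by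
  have h0 : x ⬝ᵥ ((G.laplacian + Matrix.diagonal q) *ᵥ x) = 0 := by rw [hx, dotProduct_zero]
  have hQ : x ⬝ᵥ (Matrix.diagonal q *ᵥ x) = ∑ i, q i * x i ^ 2 := by
    simp only [dotProduct, Matrix.mulVec_diagonal]
    exact Finset.sum_congr rfl fun i _ => by ring
  rw [Matrix.add_mulVec, dotProduct_add, hQ] at h0
  have hL := G.two_mul_dotProduct_laplacian_mulVec x
  have hw : ∀ i j, 0 ≤ G.w i j * (x i - x j) ^ 2 :=
    fun i j => mul_nonneg (G.nonneg i j) (sq_nonneg _)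
  have hqx : ∀ i, 0 ≤ q i * x i ^ 2 := fun i => mul_nonneg (hq i) (sq_nonneg _)
  have hL0 : 0 ≤ ∑ i, ∑ j, G.w i j * (x i - x j) ^ 2 :=
    Finset.sum_nonneg fun i _ => Finset.sum_nonneg fun j _ => hw i j
  have hQ0 : 0 ≤ ∑ i, q i * x i ^ 2 := Finset.sum_nonneg fun i _ => hqx i
  have hL1 : ∑ i, ∑ j, G.w i j * (x i - x j) ^ 2 = 0 := by linarith
  have hQ1 : ∑ i, q i * x i ^ 2 = 0 := by linarith
  have hw0 : ∀ i j, G.w i j * (x i - x j) ^ 2 = 0 := fun i j =>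
    (Finset.sum_eq_zero_iff_of_nonneg fun j _ => hw i j).1
      ((Finset.sum_eq_zero_iff_of_nonneg fun i _ => Finset.sum_nonneg fun j _ => hw i j).1 hL1 i
        (Finset.mem_univ i)) j (Finset.mem_univ j)
  have hq0 : ∀ i, q i * x i ^ 2 = 0 := fun i =>
    (Finset.sum_eq_zero_iff_of_nonneg fun i _ => hqx i).1 hQ1 i (Finset.mem_univ i)
  -- Extended by `0` at `Γ`, `x` is constant along every edge of the extended graph, hence zero by
  -- connectedness.
  have hadj : ∀ a b, (G.extend q hq).toSimpleGraph.Adj a b → a.elim 0 x = b.elim 0 x := by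
    rintro (_ | i) (_ | j) ⟨-, hpos⟩
    · rfl
    · have := hq0 j
      simpa [(show 0 < q j from hpos).ne', eq_comm] using this
    · have := hq0 i
      simpa [(show 0 < q i from hpos).ne'] using this
    · have := hw0 i j
      simpa [(show 0 < G.w i j from hpos).ne', sub_eq_zero] using this
  have hwalk : ∀ a b, (G.extend q hq).toSimpleGraph.Walk a b → a.elim 0 x = b.elim 0 x := by
    intro a b p
    induction p with
    | nil => rfl
    | cons h _ ih => exact (hadj _ _ h).trans ih
  funext i
  obtain ⟨p⟩ := hconn.preconnected (some i) none
  exact hwalk _ _ p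

theorem isUnit_laplacian_add_diagonal {q : V → ℝ} (hq : ∀ i, 0 ≤ q i)
    (hconn : (G.extend q hq).toSimpleGraph.Connected) :
    IsUnit (G.laplacian + Matrix.diagonal q) := by
  rw [← Matrix.mulVec_injective_iff_isUnit]
  intro u v huv
  rw [← sub_eq_zero]
  apply eq_zero_of_laplacian_add_diagonal_mulVec_eq_zero hq hconn
  rw [Matrix.mulVec_sub, sub_eq_zero]
  exact huv

end WeightedGraph

/-! ### Rerooting a tree and averaging over it -/

namespace RootedSpanningForest

variable {V : Type*} {G : WeightedGraph V}

open Classical in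
/-- Move the root of the tree that contains `i` to another vertex `j` of this tree. -/
def reroot (φ : RootedSpanningForest G) {i j : V} (h : φ.graph.Reachable i j) :
    RootedSpanningForest G where
  graph := φ.graph
  le := φ.le
  acyclic := φ.acyclic
  roots := insert j (φ.roots.erase (φ.root i))
  existsUnique_root a := by
    simp only [Finset.mem_insert, Finset.mem_erase]
    by_cases ha : φ.graph.Reachable a i
    · refine ⟨j, ⟨.inl rfl, ha.trans h⟩, ?_⟩
      rintro r ⟨rfl | ⟨hne, hr⟩, har⟩
      · rfl
      · exact absurd (root_eq hr (ha.symm.trans har)).symm hne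
    · refine ⟨φ.root a, ⟨.inr ⟨fun hr => ha ?_, φ.root_mem a⟩, φ.reachable_root a⟩, ?_⟩
      · exact (φ.reachable_root a).trans (hr ▸ (φ.reachable_root i).symm)
      · rintro r ⟨rfl | ⟨hne, hr⟩, har⟩
        · exact absurd (har.trans h.symm) ha
        · exact (root_eq hr har).symm

theorem root_reroot (φ : RootedSpanningForest G) {i j : V} (h : φ.graph.Reachable i j) :
    (φ.reroot h).root i = j :=
  root_eq (by simp [reroot]) h

theorem partition_reroot (φ : RootedSpanningForest G) {i j : V} (h : φ.graph.Reachable i j) :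
    (φ.reroot h).partition = φ.partition := rfl

theorem eq_root_of_mem_roots {φ : RootedSpanningForest G} {i j : V} (hj : j ∈ φ.roots)
    (h : φ.graph.Reachable i j) : j = φ.root i := (root_eq hj h).symm

theorem reroot_reroot (φ : RootedSpanningForest G) {i j : V} (h : φ.graph.Reachable i j) :
    (φ.reroot h).reroot (φ.reachable_root i) = φ := by
  classical
  ext1
  · rfl
  · have hroot := φ.root_reroot h
    simp only [reroot] at hroot ⊢
    ext a
    simp only [hroot, Finset.mem_insert, Finset.mem_erase]
    constructor
    · rintro (rfl | ⟨haj, rfl | ⟨-, ha⟩⟩)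
      · exact φ.root_mem i
      · exact absurd rfl haj
      · exact ha
    · intro ha
      by_cases har : a = φ.root i
      · exact .inl har
      · refine .inr ⟨?_, .inr ⟨har, ha⟩⟩
        rintro rfl
        exact har (eq_root_of_mem_roots ha h)

variable [Fintype V]

theorem mem_tree {φ : RootedSpanningForest G} {i j : V} :
    j ∈ φ.tree i ↔ φ.graph.Reachable i j := by
  classical
  simp only [tree, Finset.mem_filter, Finset.mem_univ, true_and]
  rfl

theorem tree_eq_tree {φ : RootedSpanningForest G} {i j : V} (h : φ.graph.Reachable i j) :
    φ.tree i = φ.tree j := by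
  ext k
  rw [mem_tree, mem_tree]
  exact ⟨h.symm.trans, h.trans⟩

theorem tree_eq_of_partition_eq {φ ψ : RootedSpanningForest G} (h : φ.partition = ψ.partition)
    (i : V) : φ.tree i = ψ.tree i := by
  ext j
  rw [mem_tree, mem_tree]
  exact iff_of_eq (congrArg (fun P : Setoid V => P i j) h)

/-- The edges are unchanged and one root factor is replaced. The multiplied-out form allows `q` to
vanish. -/
theorem weight_reroot (φ : RootedSpanningForest G) {i j : V} (h : φ.graph.Reachable i j)
    (q : V → ℝ) : (φ.reroot h).weight q * q (φ.root i) = φ.weight q * q j := by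
  classical
  have hj : j ∉ φ.roots.erase (φ.root i) := by
    rw [Finset.mem_erase]
    exact fun ⟨hne, hj⟩ => hne (eq_root_of_mem_roots hj h)
  have h1 : ∏ a ∈ (φ.reroot h).roots, q a = q j * ∏ a ∈ φ.roots.erase (φ.root i), q a := by
    rw [← Finset.prod_insert hj]
    simp only [reroot]
  rw [weight, weight, h1, ← Finset.mul_prod_erase φ.roots q (φ.root_mem i)]
  have h2 : (φ.reroot h).graph = φ.graph := rfl
  rw [h2]
  ring

/-- Expand into pairs (forest, vertex `j` of the tree of `i`). Moving the root to `j` and recording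
the old root is an involution that keeps the partition and matches the terms. -/
theorem sum_weight_mul_root_mul_sum_tree (q y : V → ℝ) (g : Setoid V → ℝ) (i : V) :
    ∑ φ : RootedSpanningForest G,
        g φ.partition * (φ.weight q * y (φ.root i) * ∑ j ∈ φ.tree i, q j) =
      ∑ φ : RootedSpanningForest G, g φ.partition * (φ.weight q * ∑ j ∈ φ.tree i, y j * q j) := by
  classical
  simp only [Finset.mul_sum, Finset.sum_sigma']
  refine Finset.sum_bij'
    (fun p hp => ⟨p.1.reroot (mem_tree.1 (Finset.mem_sigma.1 hp).2), p.1.root i⟩)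
    (fun p hp => ⟨p.1.reroot (mem_tree.1 (Finset.mem_sigma.1 hp).2), p.1.root i⟩) ?_ ?_ ?_ ?_ ?_
  · rintro ⟨φ, j⟩ hp
    simp only [Finset.mem_sigma, Finset.mem_univ, true_and, mem_tree]
    exact φ.reachable_root i
  · rintro ⟨φ, j⟩ hp
    simp only [Finset.mem_sigma, Finset.mem_univ, true_and, mem_tree]
    exact φ.reachable_root i
  · rintro ⟨φ, j⟩ hp
    simp only [reroot_reroot, root_reroot]
  · rintro ⟨φ, j⟩ hp
    simp only [reroot_reroot, root_reroot]
  · rintro ⟨φ, j⟩ hp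
    have := φ.weight_reroot (mem_tree.1 (Finset.mem_sigma.1 hp).2) q
    simp only [partition_reroot]
    linear_combination (- g φ.partition * y (φ.root i)) * this

theorem sum_tree_pos_of_weight_ne_zero {φ : RootedSpanningForest G} {q : V → ℝ}
    (hq : ∀ i, 0 ≤ q i) (hφ : φ.weight q ≠ 0) (i : V) : 0 < ∑ j ∈ φ.tree i, q j := by
  refine Finset.sum_pos' (fun j _ => hq j) ⟨φ.root i, mem_tree.2 (φ.reachable_root i), ?_⟩
  exact (hq _).lt_of_ne' (Finset.prod_ne_zero_iff.1 (left_ne_zero_of_mul hφ) _ (φ.root_mem i))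

/-- Weighted sums of `x̃` and `x̄` agree on every set of forests that is determined by the
partition into trees. -/
theorem sum_weight_mul_xtilde (q : V → ℝ) (hq : ∀ i, 0 ≤ q i) (y : V → ℝ) (g : Setoid V → ℝ)
    (i : V) :
    ∑ φ : RootedSpanningForest G, g φ.partition * (φ.weight q * φ.xtilde y i) =
      ∑ φ : RootedSpanningForest G, g φ.partition * (φ.weight q * φ.xbar q y i) := by
  classical
  -- The total `q` of the tree of `i` depends only on the partition, so dividing by it is absorbed
  -- into `g`.
  have key := sum_weight_mul_root_mul_sum_tree (G := G) q y
    (fun P => g P / ∑ j with P i j, q j) i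
  have htree : ∀ φ : RootedSpanningForest G, ∑ j with φ.partition i j, q j = ∑ j ∈ φ.tree i, q j :=
    fun φ => by simp only [tree]
  simp only [htree] at key
  refine Eq.trans (Finset.sum_congr rfl fun φ _ => ?_)
    (key.trans (Finset.sum_congr rfl fun φ _ => ?_))
  · by_cases hφ : φ.weight q = 0
    · simp [hφ]
    · have := (sum_tree_pos_of_weight_ne_zero hq hφ i).ne'
      rw [xtilde]
      field_simp
  · rw [xbar]
    ring

/-! ### The averaging matrix `S` -/

theorem S_apply_of_mem {φ : RootedSpanningForest G} {i j : V} (q : V → ℝ) (h : j ∈ φ.tree i) :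
    φ.S q i j = q j / ∑ k ∈ φ.tree i, q k := by
  rw [S, Matrix.of_apply, if_pos h, mul_one]

theorem S_apply_of_notMem {φ : RootedSpanningForest G} {i j : V} (q : V → ℝ)
    (h : j ∉ φ.tree i) : φ.S q i j = 0 := by
  rw [S, Matrix.of_apply, if_neg h, mul_zero, zero_div]

theorem xbar_eq_S_mulVec (φ : RootedSpanningForest G) (q y : V → ℝ) :
    φ.xbar q y = φ.S q *ᵥ y := by
  funext i
  simp only [xbar, Matrix.mulVec, dotProduct]
  rw [Finset.sum_div, ← Finset.sum_subset (Finset.subset_univ (φ.tree i))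
    fun j _ hj => by rw [S_apply_of_notMem q hj, zero_mul]]
  exact Finset.sum_congr rfl fun j hj => by rw [S_apply_of_mem q hj]; ring

theorem transpose_S_mul_diagonal_mul_S [DecidableEq V] (φ : RootedSpanningForest G)
    (q : V → ℝ) : (φ.S q)ᵀ * Matrix.diagonal q * φ.S q = Matrix.diagonal q * φ.S q := by
  classical
  ext j k
  rw [Matrix.diagonal_mul, Matrix.mul_apply]
  simp only [Matrix.mul_diagonal, Matrix.transpose_apply]
  -- Rows of `S` agree within a tree, so summing over `i` produces the total `q` of the tree, which
  -- cancels the denominator.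
  have hterm : ∀ i, φ.S q i j * q i * φ.S q i k =
      (if i ∈ φ.tree j then q i else 0) * (q j / (∑ l ∈ φ.tree j, q l) * φ.S q j k) := by
    intro i
    by_cases hij : φ.graph.Reachable i j
    · have h1 : φ.S q i k = φ.S q j k := by
        have ht := tree_eq_tree hij
        by_cases hk : k ∈ φ.tree j
        · rw [S_apply_of_mem q hk, S_apply_of_mem q (ht ▸ hk), ht]
        · rw [S_apply_of_notMem q hk, S_apply_of_notMem q (ht ▸ hk)]
      have h2 : φ.S q i j = q j / ∑ l ∈ φ.tree j, q l := by
        rw [S_apply_of_mem q (mem_tree.2 hij), tree_eq_tree hij]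
      rw [h1, h2, if_pos (mem_tree.2 hij.symm)]
      ring
    · rw [if_neg (fun h => hij (mem_tree.1 h).symm)]
      simp [S_apply_of_notMem q (fun h => hij (mem_tree.1 h))]
  simp only [hterm, ← Finset.sum_mul, Finset.sum_ite_mem, Finset.univ_inter]
  -- When the total is `0`, the row `j` of `S` is zero by the convention on division.
  by_cases hT : ∑ l ∈ φ.tree j, q l = 0
  · simp [S, hT]
  · field_simp

/-- The `q`-weighted square norm of `x̄` is its `q`-weighted inner product with `y`. -/
theorem sum_mul_xbar_sq (φ : RootedSpanningForest G) (q y : V → ℝ) :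
    ∑ i, q i * φ.xbar q y i ^ 2 = ∑ i, q i * y i * φ.xbar q y i := by
  classical
  have h := congrArg (fun M => y ⬝ᵥ (M *ᵥ y)) (φ.transpose_S_mul_diagonal_mul_S q)
  simp only [← Matrix.mulVec_mulVec, ← xbar_eq_S_mulVec, Matrix.dotProduct_mulVec y (φ.S q)ᵀ,
    Matrix.vecMul_transpose] at h
  simp only [dotProduct, Matrix.mulVec_diagonal] at h
  calc _ = _ := Finset.sum_congr rfl fun i _ => by ring
    _ = _ := h
    _ = _ := Finset.sum_congr rfl fun i _ => by ring

theorem sum_weight_mul_root [DecidableEq V] {q : V → ℝ} (hq : ∀ i, 0 ≤ q i)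
    (hconn : (G.extend q hq).toSimpleGraph.Connected) (y : V → ℝ) (i : V) :
    ∑ φ : RootedSpanningForest G, φ.weight q * y (φ.root i) =
      (∑ φ : RootedSpanningForest G, φ.weight q) * (G.kernel q *ᵥ y) i := by
  have hunit := (Matrix.isUnit_iff_isUnit_det _).1 (G.isUnit_laplacian_add_diagonal hq hconn)
  have h := laplacian_mulVec_sum_root (G := G) q hq y
  have h' : (fun i => q i * y i * ∑ φ : RootedSpanningForest G, φ.weight q) =
      (∑ φ : RootedSpanningForest G, φ.weight q) • (Matrix.diagonal q *ᵥ y) := by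
    funext i
    rw [Pi.smul_apply, Matrix.mulVec_diagonal, smul_eq_mul, mul_comm]
  have h2 := congrArg ((G.laplacian + Matrix.diagonal q)⁻¹ *ᵥ ·) (h.trans h')
  simp only [Matrix.mulVec_mulVec, Matrix.nonsing_inv_mul _ hunit, Matrix.one_mulVec,
    Matrix.mulVec_smul] at h2
  exact congrFun h2 i

end RootedSpanningForest

/-! ### Expectations, conditioning and variance -/

namespace IsRandomSpanningForest

variable {V : Type*} [Fintype V] {G : WeightedGraph V} {q : V → ℝ} {Ω : Type*}
  [MeasurableSpace Ω] {μ : Measure Ω} {Φ : Ω → RootedSpanningForest G}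

theorem memLp_comp [IsFiniteMeasure μ] (hΦ : Measurable Φ) (g : RootedSpanningForest G → ℝ)
    (p : ENNReal) : MemLp (fun ω => g (Φ ω)) p μ :=
  have : DiscreteMeasurableSpace (RootedSpanningForest G) := ⟨fun _ => trivial⟩
  (MemLp.of_discrete (f := g) (p := p) (μ := μ.map Φ)).comp_of_map hΦ.aemeasurable

theorem integrable_comp [IsFiniteMeasure μ] (hΦ : Measurable Φ)
    (g : RootedSpanningForest G → ℝ) : Integrable (fun ω => g (Φ ω)) μ :=
  memLp_one_iff_integrable.1 (memLp_comp hΦ g 1)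

theorem integral_comp [IsFiniteMeasure μ] (hΦ : Measurable Φ) (g : RootedSpanningForest G → ℝ) :
    ∫ ω, g (Φ ω) ∂μ = ∑ φ, μ.real {ω | Φ ω = φ} * g φ := by
  have : DiscreteMeasurableSpace (RootedSpanningForest G) := ⟨fun _ => trivial⟩
  rw [← integral_map hΦ.aemeasurable .of_discrete, integral_fintype Integrable.of_finite]
  refine Finset.sum_congr rfl fun φ _ => ?_
  rw [map_measureReal_apply hΦ trivial, smul_eq_mul]
  rfl

/-- The conditional expectation of `x̃` given the partition into trees is `x̄`. -/
theorem integral_cond_xtilde [IsFiniteMeasure μ] (hΦ : IsRandomSpanningForest q μ Φ)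
    (hq : ∀ i, 0 ≤ q i) (y : V → ℝ) (φ : RootedSpanningForest G)
    (hφ : μ {ω | (Φ ω).partition = φ.partition} ≠ 0) (i : V) :
    ∫ ω, (Φ ω).xtilde y i ∂(μ[|{ω | (Φ ω).partition = φ.partition}]) = φ.xbar q y i := by
  classical
  set A : Set Ω := {ω | (Φ ω).partition = φ.partition} with hA
  have hAm : MeasurableSet A := hΦ.measurable (t := {ψ | ψ.partition = φ.partition}) trivial
  have := cond_isProbabilityMeasure (μ := μ) hφ
  obtain ⟨c, hc⟩ := hΦ.law
  -- The conditioned law is the forest weight times a function of the partition, the form in which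
  -- rerooting applies.
  have hlaw : ∀ ψ, (μ[|A]).real {ω | Φ ω = ψ} =
      ((μ.real A)⁻¹ * c * if ψ.partition = φ.partition then 1 else 0) * ψ.weight q := by
    intro ψ
    rw [measureReal_def, cond_apply hAm, ENNReal.toReal_mul, ENNReal.toReal_inv, ← measureReal_def,
      ← measureReal_def]
    split_ifs with h
    · rw [Set.inter_eq_self_of_subset_right, hc]
      · ring
      · rintro ω rfl
        exact h
    · rw [(Set.disjoint_left.2 _ : Disjoint A {ω | Φ ω = ψ}).inter_eq]
      · simp
      · rintro ω hω rfl
        exact h hω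
  have h1 : ∫ ω, (Φ ω).xtilde y i ∂(μ[|A]) = ∫ ω, (Φ ω).xbar q y i ∂(μ[|A]) := by
    rw [integral_comp hΦ.measurable (fun ψ => ψ.xtilde y i),
      integral_comp hΦ.measurable (fun ψ => ψ.xbar q y i)]
    simp only [hlaw, mul_assoc _ (RootedSpanningForest.weight _ _)]
    exact RootedSpanningForest.sum_weight_mul_xtilde q hq y
      (fun P => (μ.real A)⁻¹ * c * if P = φ.partition then 1 else 0) i
  have h2 : ∫ ω, (Φ ω).xbar q y i ∂(μ[|A]) = ∫ _, φ.xbar q y i ∂(μ[|A]) := by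
    refine integral_congr_ae ((ae_cond_mem hAm).mono fun ω hω => ?_)
    simp only [RootedSpanningForest.xbar, RootedSpanningForest.tree_eq_of_partition_eq hω]
  rw [h1, h2, integral_const, probReal_univ, one_smul]

variable [DecidableEq V] [IsProbabilityMeasure μ]

theorem integral_xbar (hΦ : IsRandomSpanningForest q μ Φ) (hq : ∀ i, 0 ≤ q i)
    (hconn : (G.extend q hq).toSimpleGraph.Connected) (y : V → ℝ) (i : V) :
    ∫ ω, (Φ ω).xbar q y i ∂μ = (G.kernel q *ᵥ y) i := by
  obtain ⟨c, hc⟩ := hΦ.law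
  have hZ : c * ∑ φ : RootedSpanningForest G, φ.weight q = 1 := by
    have := integral_comp (μ := μ) hΦ.measurable (fun _ => 1)
    simpa [hc, ← Finset.mul_sum] using this.symm
  have h := RootedSpanningForest.sum_weight_mul_xtilde (G := G) q hq y (fun _ => c) i
  rw [integral_comp hΦ.measurable (fun ψ => ψ.xbar q y i)]
  simp only [hc, mul_assoc]
  rw [← h, ← Finset.mul_sum]
  simp only [RootedSpanningForest.xtilde]
  rw [RootedSpanningForest.sum_weight_mul_root hq hconn, ← mul_assoc, hZ, one_mul]

theorem integral_S (hΦ : IsRandomSpanningForest q μ Φ) (hq : ∀ i, 0 ≤ q i)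
    (hconn : (G.extend q hq).toSimpleGraph.Connected) (i j : V) :
    ∫ ω, (Φ ω).S q i j ∂μ = G.kernel q i j := by
  -- Unbiasedness for the `j`-th basis vector gives the `j`-th column.
  have h := hΦ.integral_xbar hq hconn (Pi.single j 1) i
  simpa only [RootedSpanningForest.xbar_eq_S_mulVec, Matrix.mulVec_single_one,
    Matrix.col_apply] using h

theorem integral_weightedSqNorm (hΦ : IsRandomSpanningForest q μ Φ) (hq : ∀ i, 0 ≤ q i)
    (hconn : (G.extend q hq).toSimpleGraph.Connected) (y : V → ℝ) :
    ∫ ω, weightedSqNorm q (G.kernel q *ᵥ y - (Φ ω).xbar q y) ∂μ =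
      ∑ i, q i * Var[fun ω => (Φ ω).xbar q y i; μ] := by
  have h : ∀ φ : RootedSpanningForest G, weightedSqNorm q (G.kernel q *ᵥ y - φ.xbar q y) =
      ∑ i, q i * (φ.xbar q y i - (G.kernel q *ᵥ y) i) ^ 2 := by
    intro φ
    simp only [weightedSqNorm, dotProduct, Matrix.mulVec_diagonal, Pi.sub_apply]
    exact Finset.sum_congr rfl fun i _ => by ring
  simp only [h]
  rw [integral_finsetSum _ fun i _ => integrable_comp hΦ.measurable
    fun φ => q i * (φ.xbar q y i - (G.kernel q *ᵥ y) i) ^ 2]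
  refine Finset.sum_congr rfl fun i _ => ?_
  rw [integral_const_mul, variance_eq_integral
    (memLp_comp hΦ.measurable (fun φ => φ.xbar q y i) 2).aemeasurable,
    hΦ.integral_xbar hq hconn]

theorem sum_mul_variance_xbar (hΦ : IsRandomSpanningForest q μ Φ) (hq : ∀ i, 0 ≤ q i)
    (hconn : (G.extend q hq).toSimpleGraph.Connected) (y : V → ℝ) :
    ∑ i, q i * Var[fun ω => (Φ ω).xbar q y i; μ] =
      y ⬝ᵥ ((Matrix.diagonal q * G.kernel q
        - (G.kernel q)ᵀ * Matrix.diagonal q * G.kernel q) *ᵥ y) := by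
  have hvar : ∀ i, Var[fun ω => (Φ ω).xbar q y i; μ] =
      ∫ ω, (Φ ω).xbar q y i ^ 2 ∂μ - (G.kernel q *ᵥ y) i ^ 2 := by
    intro i
    rw [variance_eq_sub (memLp_comp hΦ.measurable (fun φ => φ.xbar q y i) 2),
      hΦ.integral_xbar hq hconn]
    rfl
  -- The second moments are found without the joint law of two roots: `sum_mul_xbar_sq` holds forest
  -- by forest and is linear in `x̄` on the right.
  have hsq : ∑ i, q i * ∫ ω, (Φ ω).xbar q y i ^ 2 ∂μ = ∑ i, q i * y i * (G.kernel q *ᵥ y) i := by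
    simp only [← integral_const_mul, ← hΦ.integral_xbar hq hconn y]
    rw [← integral_finsetSum _ fun i _ => integrable_comp hΦ.measurable
        fun φ => q i * φ.xbar q y i ^ 2,
      ← integral_finsetSum _ fun i _ => integrable_comp hΦ.measurable
        fun φ => q i * y i * φ.xbar q y i]
    simp only [RootedSpanningForest.sum_mul_xbar_sq]
  simp only [hvar, mul_sub, Finset.sum_sub_distrib, hsq]
  rw [Matrix.sub_mulVec, dotProduct_sub]
  simp only [← Matrix.mulVec_mulVec, Matrix.dotProduct_mulVec y (G.kernel q)ᵀ,
    Matrix.vecMul_transpose]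
  simp only [dotProduct, Matrix.mulVec_diagonal]
  congr 1 <;> exact Finset.sum_congr rfl fun i _ => by ring

end IsRandomSpanningForest

end

theorem proposition2 {V : Type*} [Fintype V] [DecidableEq V] (G : WeightedGraph V)
    (q : V → ℝ) (hq : ∀ i, 0 ≤ q i) (hconn : (G.extend q hq).toSimpleGraph.Connected)
    {Ω : Type*} [MeasurableSpace Ω] (μ : Measure Ω) [IsProbabilityMeasure μ]
    (Φ : Ω → RootedSpanningForest G) (hΦ : IsRandomSpanningForest q μ Φ) (y : V → ℝ) :
    -- `K` is well defined
    IsUnit (G.laplacian + Matrix.diagonal q) ∧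
    -- `x̄` is the expectation of `x̃` conditioned on the partition into trees
    (∀ φ : RootedSpanningForest G, μ {ω | (Φ ω).partition = φ.partition} ≠ 0 → ∀ i,
      ∫ ω, (Φ ω).xtilde y i ∂(μ[|{ω | (Φ ω).partition = φ.partition}]) = φ.xbar q y i) ∧
    -- `x̄ = S y`, `E[S] = K` and `Sᵀ Q S = Q S`
    (∀ φ : RootedSpanningForest G, φ.xbar q y = φ.S q *ᵥ y) ∧
    (∀ i j, Integrable (fun ω => (Φ ω).S q i j) μ ∧
      ∫ ω, (Φ ω).S q i j ∂μ = G.kernel q i j) ∧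
    (∀ φ : RootedSpanningForest G,
      (φ.S q)ᵀ * Matrix.diagonal q * φ.S q = Matrix.diagonal q * φ.S q) ∧
    -- `x̄` is unbiased
    (∀ i, MemLp (fun ω => (Φ ω).xbar q y i) 2 μ) ∧
    (∀ i, ∫ ω, (Φ ω).xbar q y i ∂μ = (G.kernel q *ᵥ y) i) ∧
    -- the weighted expected error
    ∫ ω, weightedSqNorm q (G.kernel q *ᵥ y - (Φ ω).xbar q y) ∂μ
      = ∑ i, q i * Var[fun ω => (Φ ω).xbar q y i; μ] ∧
    ∑ i, q i * Var[fun ω => (Φ ω).xbar q y i; μ]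
      = y ⬝ᵥ ((Matrix.diagonal q * G.kernel q
          - (G.kernel q)ᵀ * Matrix.diagonal q * G.kernel q) *ᵥ y) := by
  exact ⟨G.isUnit_laplacian_add_diagonal hq hconn, hΦ.integral_cond_xtilde hq y,
    fun φ => φ.xbar_eq_S_mulVec q y,
    fun i j => ⟨IsRandomSpanningForest.integrable_comp hΦ.measurable fun φ => φ.S q i j,
      hΦ.integral_S hq hconn i j⟩,
    fun φ => φ.transpose_S_mul_diagonal_mul_S q,
    fun i => IsRandomSpanningForest.memLp_comp hΦ.measurable (fun φ => φ.xbar q y i) 2,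
    hΦ.integral_xbar hq hconn y, hΦ.integral_weightedSqNorm hq hconn y,
    hΦ.sum_mul_variance_xbar hq hconn y⟩
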